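/- Let $K$ be a field of characteristic $p>0$, let $A\subseteq B$ be integral domains of finite type over $K$ ($A$ a $K$-subalgebra of $B$), and suppose that $A$ has Krull dimension one. For an ideal $J$ of a noetherian ring $R$ of characteristic $p$ let $J^{[q]}$ denote the ideal generated by all $a^q$, $a\in J$, and let the tight closure $J^*$ be the set of all $y\in R$ for which there is $t\in R$, lying in no minimal prime ideal of $R$, such that $t y^{q}\in J^{[q]}$ for all sufficiently large powers $q=p^e$. (If $R$ is a domain, this says equivalently that there is $t\neq 0$ with $ty^q\in J^{[q]}$ for all $q=p^e$, $e\ge 0$.) Let $I$ be an ideal of $B$, let $x\in B$, and put $M=A\setminus\{0\}$. Suppose that the image of $x$ in the generic fiber ring $M^{-1}B$ lies in $(M^{-1}I)^*$. Assume that the tight closure of $I$ commutes with localization at $M$, that is, $(M^{-1}I)^*=M^{-1}(I^*)$ (which is the case in particular if tight closure commutes with localization in general). Then for all but finitely many maximal ideals $\mathfrak m$ of $A$, the image of $x$ in the fiber ring $B\otimes_A A/\mathfrak m$ lies in the tight closure of the extended ideal $I\cdot(B\otimes_A A/\mathfrak m)$. -/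

import Mathlib

open scoped TensorProduct

/-- The Frobenius power `I^[q]`: the ideal generated by all `q`-th powers of elements of `I`. -/
def frobeniusPower {R : Type*} [CommRing R] (I : Ideal R) (q : ℕ) : Ideal R :=
  Ideal.span ((fun a : R => a ^ q) '' (I : Set R))

/-- The tight closure `I*` of an ideal `I` of a (noetherian) ring `R` of characteristic `p`:
the set of all `x` for which there is some `t` lying in no minimal prime of `R` with
`t * x ^ q ∈ I^[q]` for all sufficiently large powers `q = p ^ e`.
For a domain this is the set of `x` for which there is some `t ≠ 0` with `t * x ^ q ∈ I^[q]` for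
all `q = p ^ e`, see `mem_tightClosure_iff_of_isDomain`. -/
def tightClosure (p : ℕ) {R : Type*} [CommRing R] (I : Ideal R) : Set R :=
  {x | ∃ t : R, (∀ P ∈ minimalPrimes R, t ∉ P) ∧
    ∃ e₀ : ℕ, ∀ e : ℕ, e₀ ≤ e → t * x ^ p ^ e ∈ frobeniusPower I (p ^ e)}

/-- In a domain, the definition of tight closure takes its simpler form. -/
theorem mem_tightClosure_iff_of_isDomain {p : ℕ} (hp : p.Prime) {R : Type*} [CommRing R]
    [IsDomain R] (I : Ideal R) (x : R) :
    x ∈ tightClosure p I ↔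
      ∃ t : R, t ≠ 0 ∧ ∀ e : ℕ, t * x ^ p ^ e ∈ frobeniusPower I (p ^ e) := by
  have hmin : ∀ t : R, (∀ P ∈ minimalPrimes R, t ∉ P) ↔ t ≠ 0 := fun t => by
    rw [IsDomain.minimalPrimes_eq_singleton_bot]
    simp
  constructor
  · rintro ⟨t, ht', e₀, h⟩
    have ht : t ≠ 0 := (hmin t).1 ht'
    by_cases hI : I = ⊥
    · subst hI
      have h0 := h e₀ le_rfl
      have hq : p ^ e₀ ≠ 0 := (pow_pos hp.pos _).ne'
      have hx : x = 0 := by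
        simp [frobeniusPower, zero_pow hq, ht, Ideal.mem_span_singleton] at h0
        exact h0.1
      refine ⟨1, one_ne_zero, fun e => ?_⟩
      rw [hx, zero_pow (pow_pos hp.pos e).ne', mul_zero]
      exact Ideal.zero_mem _
    · obtain ⟨d, hd, hd0⟩ := Submodule.exists_mem_ne_zero_of_ne_bot hI
      refine ⟨t * d ^ p ^ e₀, mul_ne_zero ht (pow_ne_zero _ hd0), fun e => ?_⟩
      rcases le_total e₀ e with he | he
      · have := Ideal.mul_mem_left _ (d ^ p ^ e₀) (h e he)
        convert this using 1
        ring
      · have hle : p ^ e ≤ p ^ e₀ := Nat.pow_le_pow_right hp.pos he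
        have hmem : d ^ p ^ e ∈ frobeniusPower I (p ^ e) :=
          Ideal.subset_span ⟨d, hd, rfl⟩
        have := Ideal.mul_mem_left _ (t * d ^ (p ^ e₀ - p ^ e) * x ^ p ^ e) hmem
        convert this using 1
        rw [← Nat.sub_add_cancel hle, pow_add, Nat.add_sub_cancel]
        ring
  · rintro ⟨t, ht, h⟩
    exact ⟨t, (hmin t).2 ht, 0, fun e _ => h e⟩

/-- Tight closure of `I` commutes with localization at the multiplicative system `M`:
`(M⁻¹I)* = M⁻¹(I*)` in `M⁻¹R`. -/
def TightClosureCommutesWithLocalization (p : ℕ) {R : Type*} [CommRing R]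
    (M : Submonoid R) (I : Ideal R) : Prop :=
  tightClosure p (I.map (algebraMap R (Localization M))) =
    {y : Localization M | ∃ a ∈ tightClosure p I, ∃ s : M, y = Localization.mk a s}

/-! Commutation with localization yields a nonzero `a` in `A` with `a * x` in `I*`, hence one `t ≠
0` in `B` with `t * (a * x) ^ q ∈ I^[q]` for all `q`. In the fiber over `m`, `a` is a unit unless it
lies in `m`, which excludes finitely many `m`; cancelling `a ^ q` leaves the image of `t` as
multiplier. It fails only if `t` lies in a minimal prime `P` of `mB`. As `dim A = 1`, such a `P` is
minimal over a principal ideal, so by Krull it is minimal over `tB`. There are finitely many such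
`P`, and each determines `m` as its contraction. -/

theorem frobeniusPower_map_le {R S : Type*} [CommRing R] [CommRing S] (f : R →+* S)
    (I : Ideal R) (q : ℕ) : (frobeniusPower I q).map f ≤ frobeniusPower (I.map f) q := by
  rw [frobeniusPower, Ideal.map_span, Ideal.span_le]
  rintro _ ⟨_, ⟨a, ha, rfl⟩, rfl⟩
  exact Ideal.subset_span ⟨f a, Ideal.mem_map_of_mem f ha, (map_pow f a q).symm⟩

/-- In a noetherian domain, a minimal prime of a principal ideal is minimal over the ideal generated
by any of its nonzero elements. -/
theorem Ideal.mem_minimalPrimes_span_singleton_of_mem {R : Type*} [CommRing R] [IsDomain R]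
    [IsNoetherianRing R] {a t : R} {P : Ideal R} (hP : P ∈ (Ideal.span {a}).minimalPrimes)
    (ht : t ≠ 0) (htP : t ∈ P) : P ∈ (Ideal.span {t}).minimalPrimes := by
  have : P.IsPrime := hP.isPrime
  have hle : P.height ≤ 1 := Ideal.height_le_one_of_isPrincipal_of_mem_minimalPrimes _ P hP
  refine Ideal.mem_minimalPrimes_of_height_le
    ((Ideal.span_singleton_le_iff_mem P).2 htP) (hle.trans ?_)
  exact Ideal.one_le_height_span_singleton_of_mem_nonZeroDivisors
    (mem_nonZeroDivisors_of_ne_zero ht)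

/-- Over a one-dimensional domain `A`, a minimal prime of a fiber over a maximal ideal `m` is
minimal over the principal ideal generated by any nonzero element of `m`. -/
theorem Ideal.mem_minimalPrimes_span_algebraMap {A B : Type*} [CommRing A] [IsDomain A]
    [Ring.KrullDimLE 1 A] [CommRing B] [Algebra A B] {m : Ideal A} [m.IsMaximal] {P : Ideal B}
    (hP : P ∈ (m.map (algebraMap A B)).minimalPrimes) {a : A} (ha : a ∈ m) (ha0 : a ≠ 0) :
    P ∈ (Ideal.span {algebraMap A B a}).minimalPrimes := by
  have : P.IsPrime := hP.isPrime
  have hmP : m = P.comap (algebraMap A B) :=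
    Ideal.IsMaximal.eq_of_le ‹_› (Ideal.IsPrime.ne_top inferInstance)
      (Ideal.map_le_iff_le_comap.1 hP.1.2)
  refine ⟨⟨this, (Ideal.span_singleton_le_iff_mem P).2
    (hP.1.2 (Ideal.mem_map_of_mem _ ha))⟩, fun Q hQ hQP => ?_⟩
  have : Q.IsPrime := hQ.1
  have haQ : a ∈ Q.comap (algebraMap A B) := (Ideal.span_singleton_le_iff_mem Q).1 hQ.2
  -- Dimension one enters here: the contraction of `Q` is a nonzero prime, hence maximal, hence `m`,
  -- so `Q` already contains `mB`.
  have hmax : (Q.comap (algebraMap A B)).IsMaximal :=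
    Ideal.IsPrime.isMaximal_of_ne_bot inferInstance fun h => ha0 (by simpa [h] using haQ)
  have hmQ : Q.comap (algebraMap A B) = m :=
    hmax.eq_of_le (Ideal.IsMaximal.ne_top ‹_›) (hmP ▸ Ideal.comap_mono hQP)
  exact hP.2 ⟨this, Ideal.map_le_iff_le_comap.2 hmQ.ge⟩ hQP

/-- In a one-dimensional noetherian domain, a nonzero element lies in only finitely many maximal
ideals. -/
theorem MaximalSpectrum.finite_setOf_mem {A : Type*} [CommRing A] [IsDomain A]
    [IsNoetherianRing A] [Ring.KrullDimLE 1 A] {a : A} (ha : a ≠ 0) :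
    {m : MaximalSpectrum A | a ∈ m.asIdeal}.Finite := by
  refine Set.Finite.of_finite_image
    (((Ideal.span {a}).finite_minimalPrimes_of_isNoetherianRing A).subset ?_)
    (fun m _ n _ h => MaximalSpectrum.ext h)
  rintro _ ⟨m, hm, rfl⟩
  have := m.isMaximal
  -- The case `B = A` of the fiber statement.
  have hmin : m.asIdeal ∈ (m.asIdeal.map (algebraMap A A)).minimalPrimes := by
    simp [Ideal.minimalPrimes_eq_subsingleton_self]
  exact Ideal.mem_minimalPrimes_span_algebraMap hmin hm ha

/-- The fiber is `B/mB`, so `B` maps onto it with kernel `mB`. -/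
theorem Ideal.comap_tensorQuotient_mem_minimalPrimes {A B : Type*} [CommRing A] [CommRing B]
    [Algebra A B] (m : Ideal A) {P : Ideal (B ⊗[A] (A ⧸ m))}
    (hP : P ∈ minimalPrimes (B ⊗[A] (A ⧸ m))) :
    P.comap (algebraMap B (B ⊗[A] (A ⧸ m))) ∈ (m.map (algebraMap A B)).minimalPrimes := by
  let e := Algebra.TensorProduct.quotIdealMapEquivTensorQuot B m
  have he : algebraMap B (B ⊗[A] (A ⧸ m)) =
      (e : (B ⧸ m.map (algebraMap A B)) →+* B ⊗[A] (A ⧸ m)).comp (Ideal.Quotient.mk _) :=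
    RingHom.ext fun b => (e.commutes b).symm
  have hsurj : Function.Surjective (algebraMap B (B ⊗[A] (A ⧸ m))) := by
    rw [he]
    exact e.surjective.comp Ideal.Quotient.mk_surjective
  have hker : (⊥ : Ideal (B ⊗[A] (A ⧸ m))).comap (algebraMap B (B ⊗[A] (A ⧸ m))) =
      m.map (algebraMap A B) := by
    ext b
    rw [Ideal.mem_comap, Ideal.mem_bot, he, RingHom.comp_apply, ← Ideal.Quotient.eq_zero_iff_mem]
    exact e.map_eq_zero_iff
  rw [← hker, Ideal.comap_minimalPrimes_eq_of_surjective hsurj]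
  exact ⟨P, hP, rfl⟩

/-- A nonzero `t` avoids the minimal primes of all but finitely many closed fibers over a
one-dimensional base. -/
theorem finite_setOf_exists_minimalPrimes_fiber_mem {A B : Type*} [CommRing A] [IsDomain A]
    [Ring.KrullDimLE 1 A] [CommRing B] [IsDomain B] [IsNoetherianRing B] [Algebra A B]
    (hA : ¬ IsField A) {t : B} (ht : t ≠ 0) :
    {m : MaximalSpectrum A | ∃ P ∈ minimalPrimes (B ⊗[A] (A ⧸ m.asIdeal)),
      algebraMap B (B ⊗[A] (A ⧸ m.asIdeal)) t ∈ P}.Finite := by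
  refine Set.Finite.of_finite_image (f := MaximalSpectrum.asIdeal)
    ((((Ideal.span {t}).finite_minimalPrimes_of_isNoetherianRing B).image
      (Ideal.comap (algebraMap A B))).subset ?_) (fun m _ n _ h => MaximalSpectrum.ext h)
  rintro _ ⟨m, ⟨P, hP, htP⟩, rfl⟩
  have := m.isMaximal
  have hQ := Ideal.comap_tensorQuotient_mem_minimalPrimes m.asIdeal hP
  obtain ⟨a, ha, ha0⟩ :=
    Submodule.exists_mem_ne_zero_of_ne_bot (Ring.ne_bot_of_isMaximal_of_not_isField this hA)
  refine ⟨_, Ideal.mem_minimalPrimes_span_singleton_of_mem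
    (Ideal.mem_minimalPrimes_span_algebraMap hQ ha ha0) ht htP, ?_⟩
  have := hQ.isPrime
  exact (Ideal.IsMaximal.eq_of_le ‹_› (Ideal.IsPrime.ne_top inferInstance)
    (Ideal.map_le_iff_le_comap.1 hQ.1.2)).symm

theorem isUnit_algebraMap_tensorQuotient {A B : Type*} [CommRing A] [CommRing B] [Algebra A B]
    {m : Ideal A} [m.IsMaximal] {a : A} (ha : a ∉ m) :
    IsUnit (algebraMap B (B ⊗[A] (A ⧸ m)) (algebraMap A B a)) := by
  let _ := Ideal.Quotient.field m
  have h : IsUnit (Ideal.Quotient.mk m a) :=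
    isUnit_iff_ne_zero.2 fun h => ha (Ideal.Quotient.eq_zero_iff_mem.1 h)
  have := h.map (Algebra.TensorProduct.includeRight : A ⧸ m →ₐ[A] B ⊗[A] (A ⧸ m))
  rw [← IsScalarTower.algebraMap_apply A B]
  rwa [← Ideal.Quotient.algebraMap_eq, AlgHom.commutes] at this

theorem proposition1p1 {K A B : Type*} [Field K] (p : ℕ) [Fact p.Prime] [CharP K p]
    [CommRing A] [IsDomain A] [CommRing B] [IsDomain B]
    [Algebra K A] [Algebra K B] [Algebra A B] [IsScalarTower K A B]
    [Algebra.FiniteType K A] [Algebra.FiniteType K B]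
    (hAB : Function.Injective (algebraMap A B))
    (hdim : ringKrullDim A = 1)
    (I : Ideal B) (x : B)
    (hloc : TightClosureCommutesWithLocalization p
      (Algebra.algebraMapSubmonoid B (nonZeroDivisors A)) I)
    (hx : algebraMap B (Localization (Algebra.algebraMapSubmonoid B (nonZeroDivisors A))) x ∈
      tightClosure p (I.map (algebraMap B
        (Localization (Algebra.algebraMapSubmonoid B (nonZeroDivisors A)))))) :
    {m : MaximalSpectrum A | algebraMap B (B ⊗[A] (A ⧸ m.asIdeal)) x ∉
      tightClosure p (I.map (algebraMap B (B ⊗[A] (A ⧸ m.asIdeal))))}.Finite := by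
  have : IsNoetherianRing A := Algebra.FiniteType.isNoetherianRing K A
  have : IsNoetherianRing B := Algebra.FiniteType.isNoetherianRing K B
  have : Ring.KrullDimLE 1 A := Ring.krullDimLE_iff.2 (by simp [hdim])
  have hA : ¬ IsField A := fun h => by simp [ringKrullDim_eq_zero_of_isField h] at hdim
  rw [hloc] at hx
  obtain ⟨b, hb, ⟨_, a, ha, rfl⟩, hxb⟩ := hx
  have ha0 : a ≠ 0 := nonZeroDivisors.ne_zero ha
  -- Equality of fractions holds up to a factor `c ≠ 0` from `A`, which cancels in the domain `B` by
  -- injectivity.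
  have hax : algebraMap A B a * x = b := by
    rw [← Localization.mk_one_eq_algebraMap, Localization.mk_eq_mk_iff,
      Localization.r_iff_exists] at hxb
    obtain ⟨⟨_, c, hc, rfl⟩, h⟩ := hxb
    simpa [(map_ne_zero_iff _ hAB).2 (nonZeroDivisors.ne_zero hc)] using h
  obtain ⟨t, ht, htb⟩ := (mem_tightClosure_iff_of_isDomain Fact.out I b).1 hb
  refine ((MaximalSpectrum.finite_setOf_mem ha0).union
    (finite_setOf_exists_minimalPrimes_fiber_mem hA ht)).subset fun m hm => ?_
  by_contra hgood
  simp only [Set.mem_union, Set.mem_ofPred_eq, not_or, not_exists, not_and] at hgood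
  have := m.isMaximal
  refine hm ⟨_, hgood.2, 0, fun e _ => ?_⟩
  have hmem := frobeniusPower_map_le (algebraMap B (B ⊗[A] (A ⧸ m.asIdeal))) I (p ^ e)
    (Ideal.mem_map_of_mem _ (htb e))
  rw [← hax, mul_pow, mul_left_comm, map_mul, map_pow, map_mul, map_pow] at hmem
  exact (Ideal.unit_mul_mem_iff_mem _
    ((isUnit_algebraMap_tensorQuotient hgood.1).pow _)).1 hmem
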